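/- Let $G$ be a (discrete) group generated by finitely many elements $g_1,\dots,g_n$. Recall that $G$ is amenable if there is a state $\varphi$ on the $C^*$-algebra $\ell^\infty(G)$ with $\varphi({}_gf)=\varphi(f)$ for all $g\in G$ and $f\in\ell^\infty(G)$, where ${}_gf(x)=f(g^{-1}x)$. Let $\lambda$ be the left regular representation of $G$ on $\ell^2(G)$, $(\lambda(g)f)(x)=f(g^{-1}x)$, let $$A_\lambda(z)=z_0I+z_1\lambda(g_1)+\cdots+z_n\lambda(g_n),$$ and let the projective spectrum $p(A_\lambda)\subset\mathbb P^n$ be the set of points $[z_0:\cdots:z_n]$ of complex projective space for which $A_\lambda(z)$ is not invertible in $B(\ell^2(G))$. Let $H_0=\{[z_0:\cdots:z_n]\in\mathbb P^n : z_0+z_1+\cdots+z_n=0\}$. Then $G$ is amenable if and only if $H_0\subset p(A_\lambda)$. -/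

import Mathlib

open scoped LinearAlgebra.Projectivization ENNReal ComplexOrder

noncomputable section

/-! ### Projective spectrum -/

/-- The linear pencil `A(z) = z₀ A₀ + z₁ A₁ + ⋯ + zₙ Aₙ`. -/
def pencil {B : Type*} [NormedRing B] [NormedAlgebra ℂ B] {n : ℕ}
    (A : Fin (n + 1) → B) (z : Fin (n + 1) → ℂ) : B :=
  ∑ i, z i • A i

theorem pencil_smul {B : Type*} [NormedRing B] [NormedAlgebra ℂ B] {n : ℕ}
    (A : Fin (n + 1) → B) (c : ℂ) (z : Fin (n + 1) → ℂ) :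
    pencil A (c • z) = c • pencil A z := by
  simp [pencil, Finset.smul_sum, mul_smul]

/-- The projective spectrum of a tuple `A₀, …, Aₙ` of elements of a unital Banach algebra: the
points `[z]` of `ℙⁿ` at which the pencil `A(z)` is not invertible. -/
def projectiveSpectrum {B : Type*} [NormedRing B] [NormedAlgebra ℂ B] {n : ℕ}
    (A : Fin (n + 1) → B) : Set (ℙ ℂ (Fin (n + 1) → ℂ)) :=
  {z | ¬ IsUnit (pencil A z.rep)}

/-- Membership in the projective spectrum can be tested on any homogeneous coordinates. -/
theorem mk_mem_projectiveSpectrum {B : Type*} [NormedRing B] [NormedAlgebra ℂ B] {n : ℕ}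
    (A : Fin (n + 1) → B) (v : Fin (n + 1) → ℂ) (hv : v ≠ 0) :
    Projectivization.mk ℂ v hv ∈ projectiveSpectrum A ↔ ¬ IsUnit (pencil A v) := by
  obtain ⟨a, ha⟩ := Projectivization.exists_smul_eq_mk_rep ℂ v hv
  have h : pencil A (Projectivization.mk ℂ v hv).rep = a • pencil A v := by
    rw [← ha]
    exact pencil_smul A a v
  simp [projectiveSpectrum, h, isUnit_smul_iff]

/-- The projective hyperplane `H₀ = {[z] : z₀ + z₁ + ⋯ + zₙ = 0}` of `ℙⁿ`. -/
def hyperplaneZero (n : ℕ) : Set (ℙ ℂ (Fin (n + 1) → ℂ)) :=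
  {z | ∑ i, z.rep i = 0}

/-- Membership in `H₀` can be tested on any homogeneous coordinates. -/
theorem mk_mem_hyperplaneZero {n : ℕ} (v : Fin (n + 1) → ℂ) (hv : v ≠ 0) :
    Projectivization.mk ℂ v hv ∈ hyperplaneZero n ↔ ∑ i, v i = 0 := by
  obtain ⟨a, ha⟩ := Projectivization.exists_smul_eq_mk_rep ℂ v hv
  have h : ∑ i, (Projectivization.mk ℂ v hv).rep i = (a : ℂ) * ∑ i, v i := by
    rw [← ha, Finset.mul_sum]
    rfl
  simp [hyperplaneZero, h]

/-! ### Translation on `ℓ^p(G)` and the left regular representation -/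

theorem Memℓp.comp_equiv {α : Type*} {p : ℝ≥0∞} {f : α → ℂ}
    (hf : Memℓp f p) (e : Equiv.Perm α) : Memℓp (fun x => f (e x)) p := by
  rcases p.trichotomy with rfl | rfl | hp
  · exact memℓp_zero (hf.finite_dsupport.preimage e.injective.injOn)
  · refine memℓp_infty (hf.bddAbove.mono ?_)
    rintro _ ⟨x, rfl⟩
    exact ⟨e x, rfl⟩
  · exact memℓp_gen ((e.summable_iff (f := fun x => ‖f x‖ ^ p.toReal)).2 (hf.summable hp))

/-- The left translate `x ↦ f (g⁻¹ x)` of `f ∈ ℓ^p(G)`. -/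
def leftTranslate {G : Type*} [Group G] {p : ℝ≥0∞} (g : G) (f : lp (fun _ : G => ℂ) p) :
    lp (fun _ : G => ℂ) p :=
  ⟨fun x => f (g⁻¹ * x), (lp.memℓp f).comp_equiv (Equiv.mulLeft g⁻¹)⟩

@[simp]
theorem leftTranslate_apply {G : Type*} [Group G] {p : ℝ≥0∞} (g : G)
    (f : lp (fun _ : G => ℂ) p) (x : G) : leftTranslate g f x = f (g⁻¹ * x) :=
  rfl

/-- Left translation by `g`, as a surjective linear isometry of `ℓ²(G)`. -/
def leftTranslateIsometry {G : Type*} [Group G] (g : G) :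
    lp (fun _ : G => ℂ) 2 ≃ₗᵢ[ℂ] lp (fun _ : G => ℂ) 2 where
  toFun := leftTranslate g
  invFun := leftTranslate g⁻¹
  map_add' _ _ := rfl
  map_smul' _ _ := rfl
  left_inv f := by ext x; simp
  right_inv f := by ext x; simp
  norm_map' f := by
    have h2 : 0 < (2 : ℝ≥0∞).toReal := by norm_num
    rw [lp.norm_eq_tsum_rpow h2, lp.norm_eq_tsum_rpow h2]
    congr 1
    exact (Equiv.mulLeft g⁻¹).tsum_eq (fun x => ‖f x‖ ^ (2 : ℝ≥0∞).toReal)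

/-- The left regular representation `λ` of the discrete group `G`: the unitary representation on
`ℓ²(G)` with `(λ(g) f)(x) = f (g⁻¹ x)`. -/
def leftRegularRep (G : Type*) [Group G] :
    G →* unitary (lp (fun _ : G => ℂ) 2 →L[ℂ] lp (fun _ : G => ℂ) 2) where
  toFun g := Unitary.linearIsometryEquiv.symm (leftTranslateIsometry g)
  map_one' := by
    rw [← map_one Unitary.linearIsometryEquiv.symm]
    congr 1
    ext f x
    change f (1⁻¹ * x) = f x
    simp
  map_mul' g h := by
    rw [← map_mul]
    congr 1
    ext f x
    change f ((g * h)⁻¹ * x) = f (h⁻¹ * (g⁻¹ * x))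
    rw [mul_inv_rev, mul_assoc]

@[simp]
theorem leftRegularRep_apply {G : Type*} [Group G] (g : G) (f : lp (fun _ : G => ℂ) 2) (x : G) :
    (leftRegularRep G g : lp (fun _ : G => ℂ) 2 →L[ℂ] lp (fun _ : G => ℂ) 2) f x =
      f (g⁻¹ * x) :=
  rfl

/-- For a unitary representation `π` of `G` and elements `g₁, …, gₙ` of `G`, the tuple
`(I, π(g₁), …, π(gₙ))`, whose pencil is `z₀ I + z₁ π(g₁) + ⋯ + zₙ π(gₙ)`. -/
def repTuple {G H : Type*} [Group G] [NormedAddCommGroup H] [InnerProductSpace ℂ H]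
    [CompleteSpace H] (π : G →* unitary (H →L[ℂ] H)) {n : ℕ} (g : Fin n → G) :
    Fin (n + 1) → (H →L[ℂ] H) :=
  Fin.cons 1 fun i => (π (g i) : H →L[ℂ] H)

/-! ### Amenability -/

/-- A state on a unital C⋆-algebra: a positive linear functional with value `1` at the unit. -/
structure IsState {A : Type*} [NormedRing A] [StarRing A] [NormedAlgebra ℂ A]
    (φ : A →L[ℂ] ℂ) : Prop where
  nonneg : ∀ a, 0 ≤ φ (star a * a)
  map_one : φ 1 = 1

/-- A discrete group `G` is amenable if there is a left invariant mean on it, that is, a state on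
`ℓ^∞(G)` that is invariant under left translation. -/
def IsAmenableGroup (G : Type*) [Group G] : Prop :=
  ∃ φ : lp (fun _ : G => ℂ) ∞ →L[ℂ] ℂ,
    IsState φ ∧ ∀ (g : G) (f : lp (fun _ : G => ℂ) ∞), φ (leftTranslate g f) = φ f

end

noncomputable section

open Filter Topology

/-! ### States on `ℓ^∞(G)` -/

/-! Both sides are equivalent to `HasAlmostInvariantVectors g`: unit vectors of `ℓ²(G)` moved
arbitrarily little by every generator. An invariant mean yields almost invariant probability
densities in `ℓ¹` by Hahn–Banach, and their square roots are such vectors; conversely, a weak-*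
limit of vector states is an invariant mean. If the coordinates of `z` sum to zero, the pencil sends
`x` to `∑ zᵢ (λ(gᵢ)x - x)`, so almost invariant vectors prevent invertibility. For the converse the
single point `[-n : 1 : ⋯ : 1]` suffices, since there `-2 Re⟪A x, x⟫ = ∑ ‖λ(gᵢ)x - x‖²`. -/

theorem IsState.nonneg_of_forall_nonneg {G : Type*} {φ : lp (fun _ : G => ℂ) ∞ →L[ℂ] ℂ}
    (hφ : IsState φ) (f : lp (fun _ : G => ℂ) ∞) (hf : ∀ t, 0 ≤ f t) : 0 ≤ φ f := by
  have hmem : Memℓp (fun t => ((Real.sqrt ‖f t‖ : ℝ) : ℂ)) ∞ := by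
    refine memℓp_infty ⟨Real.sqrt ‖f‖, ?_⟩
    rintro _ ⟨t, rfl⟩
    simp only [Complex.norm_real, Real.norm_eq_abs, abs_of_nonneg (Real.sqrt_nonneg _)]
    exact Real.sqrt_le_sqrt (lp.norm_apply_le_norm (by simp) f t)
  let a : lp (fun _ : G => ℂ) ∞ := ⟨_, hmem⟩
  have ha : star a * a = f := by
    ext t
    change star ((Real.sqrt ‖f t‖ : ℝ) : ℂ) * ((Real.sqrt ‖f t‖ : ℝ) : ℂ) = f t
    rw [Complex.star_def, Complex.conj_ofReal, ← Complex.ofReal_mul,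
      Real.mul_self_sqrt (norm_nonneg _)]
    exact (Complex.eq_coe_norm_of_nonneg (hf t)).symm
  rw [← ha]
  exact hφ.nonneg a

/-! ### Vector states on `ℓ^∞(G)` -/

/-- The action of `ℓ^∞(G)` on `ℓ²(G)` by pointwise multiplication. -/
def lpMulL (G : Type*) :
    lp (fun _ : G => ℂ) ∞ →L[ℂ] lp (fun _ : G => ℂ) 2 →L[ℂ] lp (fun _ : G => ℂ) 2 :=
  lp.holderL (K := 1) 2 (fun _ => ContinuousLinearMap.mul ℂ ℂ)
    (fun _ => by simp)

@[simp]
theorem lpMulL_apply {G : Type*} (f : lp (fun _ : G => ℂ) ∞) (x : lp (fun _ : G => ℂ) 2) (t : G) :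
    lpMulL G f x t = f t * x t :=
  rfl

theorem norm_lpMulL_apply_le {G : Type*} (f : lp (fun _ : G => ℂ) ∞)
    (x : lp (fun _ : G => ℂ) 2) : ‖lpMulL G f x‖ ≤ ‖f‖ * ‖x‖ := by
  have h : ‖lpMulL G‖ ≤ 1 := lp.norm_holderL_le (K := 1) 2 _ _
  calc ‖lpMulL G f x‖ ≤ ‖lpMulL G‖ * ‖f‖ * ‖x‖ := (lpMulL G).le_opNorm₂ f x
    _ ≤ 1 * ‖f‖ * ‖x‖ := by gcongr
    _ = ‖f‖ * ‖x‖ := by rw [one_mul]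

/-- The functional `f ↦ ⟪x, f x⟫ = ∑ f(t) |x(t)|²` on `ℓ^∞(G)` given by a vector `x ∈ ℓ²(G)`. -/
def vectorFunctional {G : Type*} (x : lp (fun _ : G => ℂ) 2) : lp (fun _ : G => ℂ) ∞ →L[ℂ] ℂ :=
  (innerSL ℂ x) ∘L ((lpMulL G).flip x)

theorem vectorFunctional_apply {G : Type*} (x : lp (fun _ : G => ℂ) 2)
    (f : lp (fun _ : G => ℂ) ∞) : vectorFunctional x f = inner ℂ x (lpMulL G f x) :=
  rfl

theorem norm_vectorFunctional_le {G : Type*} (x : lp (fun _ : G => ℂ) 2) (hx : ‖x‖ = 1) :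
    ‖vectorFunctional x‖ ≤ 1 := by
  refine ContinuousLinearMap.opNorm_le_bound _ zero_le_one fun f => ?_
  have h1 := norm_inner_le_norm (𝕜 := ℂ) x (lpMulL G f x)
  have h2 := norm_lpMulL_apply_le f x
  rw [hx] at h1 h2
  rw [vectorFunctional_apply]
  linarith

theorem isState_vectorFunctional {G : Type*} (x : lp (fun _ : G => ℂ) 2) (hx : ‖x‖ = 1) :
    IsState (vectorFunctional x) where
  nonneg a := by
    have h : vectorFunctional x (star a * a) = inner ℂ (lpMulL G a x) (lpMulL G a x) := by
      rw [vectorFunctional_apply, lp.inner_eq_tsum, lp.inner_eq_tsum]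
      congr 1
      ext t
      simp only [lpMulL_apply, RCLike.inner_apply, lp.infty_coeFn_mul, Pi.mul_apply,
        lp.star_apply, map_mul, Complex.star_def]
      ring
    rw [h, inner_self_eq_norm_sq_to_K]
    norm_cast
    exact Complex.zero_le_real.2 (sq_nonneg ‖lpMulL G a x‖)
  map_one := by
    have h : lpMulL G 1 x = x := by
      ext t
      simp
    rw [vectorFunctional_apply, h, inner_self_eq_norm_sq_to_K, hx]
    simp

theorem vectorFunctional_leftTranslate {G : Type*} [Group G] (s : G)
    (x : lp (fun _ : G => ℂ) 2) (f : lp (fun _ : G => ℂ) ∞) :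
    vectorFunctional (leftTranslate s x) (leftTranslate s f) = vectorFunctional x f := by
  rw [vectorFunctional_apply, vectorFunctional_apply, lp.inner_eq_tsum, lp.inner_eq_tsum]
  exact (Equiv.mulLeft s⁻¹).tsum_eq fun t => inner ℂ (x t) (lpMulL G f x t)

theorem norm_vectorFunctional_sub_le {G : Type*} (x y : lp (fun _ : G => ℂ) 2)
    (f : lp (fun _ : G => ℂ) ∞) :
    ‖vectorFunctional x f - vectorFunctional y f‖ ≤ ‖f‖ * (‖x‖ + ‖y‖) * ‖x - y‖ := by
  have h : vectorFunctional x f - vectorFunctional y f =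
      inner ℂ (x - y) (lpMulL G f x) + inner ℂ y (lpMulL G f (x - y)) := by
    rw [vectorFunctional_apply, vectorFunctional_apply, map_sub, inner_sub_left, inner_sub_right]
    ring
  rw [h]
  calc _ ≤ ‖x - y‖ * ‖lpMulL G f x‖ + ‖y‖ * ‖lpMulL G f (x - y)‖ :=
        norm_add_le_of_le (norm_inner_le_norm _ _) (norm_inner_le_norm _ _)
    _ ≤ ‖x - y‖ * (‖f‖ * ‖x‖) + ‖y‖ * (‖f‖ * ‖x - y‖) := by
        gcongr <;> exact norm_lpMulL_apply_le _ _
    _ = _ := by ring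

theorem norm_leftTranslate {G : Type*} [Group G] (s : G) (x : lp (fun _ : G => ℂ) 2) :
    ‖leftTranslate s x‖ = ‖x‖ :=
  (leftTranslateIsometry s).norm_map x

theorem leftTranslate_mul {G : Type*} [Group G] {p : ℝ≥0∞} (s t : G)
    (f : lp (fun _ : G => ℂ) p) :
    leftTranslate (s * t) f = leftTranslate s (leftTranslate t f) := by
  ext x
  simp [mul_assoc]

theorem leftTranslate_one {G : Type*} [Group G] {p : ℝ≥0∞} (f : lp (fun _ : G => ℂ) p) :
    leftTranslate 1 f = f := by
  ext x
  simp

/-! ### Almost invariant vectors -/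

/-- The left regular representation has almost invariant unit vectors for the tuple `g`. -/
def HasAlmostInvariantVectors {G : Type*} [Group G] {n : ℕ} (g : Fin n → G) : Prop :=
  ∀ ε : ℝ, 0 < ε → ∃ x : lp (fun _ : G => ℂ) 2, ‖x‖ = 1 ∧ ∀ i, ‖leftTranslate (g i) x - x‖ ≤ ε

/-- The vector states lie in the weak-* compact unit ball, so they converge along a nonprincipal
ultrafilter. Almost invariance makes the limit invariant. -/
theorem HasAlmostInvariantVectors.isAmenableGroup {G : Type*} [Group G] {n : ℕ} {g : Fin n → G}
    (h : HasAlmostInvariantVectors g) (hg : Subgroup.closure (Set.range g) = ⊤) :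
    IsAmenableGroup G := by
  choose x hx1 hx using fun k : ℕ => h (1 / ((k : ℝ) + 1)) Nat.one_div_pos_of_nat
  let ψ : ℕ → WeakDual ℂ (lp (fun _ : G => ℂ) ∞) :=
    fun k => StrongDual.toWeakDual (vectorFunctional (x k))
  have hψ (k : ℕ) (f : lp (fun _ : G => ℂ) ∞) : ψ k f = vectorFunctional (x k) f := rfl
  obtain ⟨φ, -, hφ⟩ := (WeakDual.isCompact_closedBall (𝕜 := ℂ)
      (0 : StrongDual ℂ (lp (fun _ : G => ℂ) ∞)) 1).ultrafilter_le_nhds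
    ((hyperfilter ℕ).map ψ) (by
      refine le_principal_iff.2 (Filter.mem_map.2 (Filter.univ_mem' fun k => ?_))
      change _ ∈ Metric.closedBall _ _
      rw [mem_closedBall_zero_iff]
      exact norm_vectorFunctional_le (x k) (hx1 k))
  have hlim (f : lp (fun _ : G => ℂ) ∞) :
      Tendsto (fun k => vectorFunctional (x k) f) (hyperfilter ℕ) (𝓝 (φ f)) :=
    ((WeakDual.eval_continuous f).tendsto φ).comp (show Tendsto ψ (hyperfilter ℕ) (𝓝 φ) from hφ)
  refine ⟨WeakDual.toStrongDual φ, ⟨fun a => ?_, ?_⟩, fun s => ?_⟩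
  · exact ge_of_tendsto (hlim _)
      (Eventually.of_forall fun k => (isState_vectorFunctional (x k) (hx1 k)).nonneg a)
  · refine tendsto_nhds_unique (hlim 1) ?_
    simp_rw [(isState_vectorFunctional (x _) (hx1 _)).map_one]
    exact tendsto_const_nhds
  · have hs : s ∈ Subgroup.closure (Set.range g) := hg ▸ Subgroup.mem_top s
    -- The elements that fix `φ` form a subgroup, so generators suffice.
    change ∀ f, φ (leftTranslate s f) = φ f
    induction hs using Subgroup.closure_induction with
    | mem s hs =>
      obtain ⟨i, rfl⟩ := hs
      intro f
      refine tendsto_nhds_unique (hlim _) ?_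
      have hdiff : Tendsto (fun k => vectorFunctional (x k) (leftTranslate (g i) f) -
          vectorFunctional (x k) f) (hyperfilter ℕ) (𝓝 0) := by
        have h0 : Tendsto (fun k : ℕ => ‖leftTranslate (g i) f‖ * 2 * (1 / ((k : ℝ) + 1)))
            (hyperfilter ℕ) (𝓝 0) := by
          have := (tendsto_one_div_add_atTop_nhds_zero_nat (𝕜 := ℝ)).const_mul
            (‖leftTranslate (g i) f‖ * 2)
          rw [mul_zero] at this
          exact this.mono_left Nat.hyperfilter_le_atTop
        refine squeeze_zero_norm (fun k => ?_) h0
        -- Both functionals now act on the same function and differ only in their vectors, `x k` and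
        -- its translate.
        rw [← vectorFunctional_leftTranslate (g i) (x k) f]
        refine (norm_vectorFunctional_sub_le _ _ _).trans ?_
        rw [norm_leftTranslate, hx1, norm_sub_rev, one_add_one_eq_two]
        gcongr
        exact hx k i
      simpa using hdiff.add (hlim f)
    | one => intro f; rw [leftTranslate_one]
    | mul s t _ _ hs ht => intro f; rw [leftTranslate_mul, hs, ht]
    | inv s _ hs =>
      intro f
      rw [← hs, ← leftTranslate_mul, mul_inv_cancel, leftTranslate_one]

/-! ### Reiter's condition -/

/-- Left translation on `ℓ^p(G)` as a real-linear map. -/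
def leftTranslateₗ {G : Type*} [Group G] (p : ℝ≥0∞) (s : G) :
    lp (fun _ : G => ℂ) p →ₗ[ℝ] lp (fun _ : G => ℂ) p where
  toFun := leftTranslate s
  map_add' _ _ := rfl
  map_smul' _ _ := rfl

theorem leftTranslate_single {G : Type*} [Group G] [DecidableEq G] (p : ℝ≥0∞) (s t : G) (a : ℂ) :
    leftTranslate s (lp.single p t a : lp (fun _ : G => ℂ) p) = lp.single p (s * t) a := by
  ext x
  simp only [leftTranslate_apply, lp.single_apply, Pi.single_apply, inv_mul_eq_iff_eq_mul]

theorem IsAmenableGroup.exists_almost_invariant_prob {G : Type*} [Group G]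
    (h : IsAmenableGroup G) {n : ℕ} (g : Fin n → G) {ε : ℝ} (hε : 0 < ε) :
    ∃ p : lp (fun _ : G => ℂ) 1, (∀ t, 0 ≤ p t) ∧ HasSum p 1 ∧
      ∀ i, ‖leftTranslate (g i) p - p‖ < ε := by
  classical
  obtain ⟨φ, hφ, hinv⟩ := h
  by_contra! hno
  let P : Set (lp (fun _ : G => ℂ) 1) := {p | (∀ t, 0 ≤ p t) ∧ HasSum p 1}
  have hP : Convex ℝ P := by
    rintro p ⟨hp0, hp1⟩ q ⟨hq0, hq1⟩ a b ha hb hab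
    refine ⟨fun t => ?_, ?_⟩
    · change 0 ≤ a • p t + b • q t
      exact add_nonneg (smul_nonneg ha (hp0 t)) (smul_nonneg hb (hq0 t))
    · have := (hp1.const_smul a).add (hq1.const_smul b)
      rwa [← add_smul, hab, one_smul] at this
  let L : lp (fun _ : G => ℂ) 1 →ₗ[ℝ] (Fin n → lp (fun _ : G => ℂ) 1) :=
    LinearMap.pi fun i => leftTranslateₗ 1 (g i) - LinearMap.id
  have h0 : (0 : Fin n → lp (fun _ : G => ℂ) 1) ∉ closure (L '' P) := by
    rw [Metric.mem_closure_iff]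
    push Not
    refine ⟨ε, hε, ?_⟩
    rintro _ ⟨p, ⟨hp0, hp1⟩, rfl⟩
    obtain ⟨i, hi⟩ := hno p hp0 hp1
    rw [dist_zero_left]
    exact hi.trans (norm_le_pi_norm (L p) i)
  -- The failure of the claim keeps the convex set `L '' P` at distance at least `ε` from `0`, so a
  -- real functional is at least `u > 0` on it.
  obtain ⟨ℓ, u, hu, hℓ⟩ := geometric_hahn_banach_point_closed
    (hP.linear_image L).closure isClosed_closure h0
  rw [map_zero] at hu
  let δ : G → lp (fun _ : G => ℂ) 1 := fun t => lp.single 1 t 1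
  have hδ (t : G) : δ t ∈ P := by
    refine ⟨fun s => ?_, ?_⟩
    · simp only [δ, lp.single_apply, Pi.single_apply]
      split_ifs <;> simp
    · exact hasSum_pi_single t (1 : ℂ)
  have hc (i : Fin n) : Memℓp (fun t => ((ℓ (Pi.single i (δ t)) : ℝ) : ℂ)) ∞ := by
    refine memℓp_infty ⟨‖ℓ‖, ?_⟩
    rintro _ ⟨t, rfl⟩
    simp only [Complex.norm_real]
    refine (ℓ.le_opNorm _).trans ?_
    rw [Pi.norm_single, lp.norm_single (by simp)]
    simp
  let F : Fin n → lp (fun _ : G => ℂ) ∞ := fun i => ⟨_, hc i⟩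
  -- `D` records `ℓ ∘ L` on point masses, so `D ≥ u > 0` pointwise; as a sum of differences of
  -- translates it is also killed by `φ`.
  let D : lp (fun _ : G => ℂ) ∞ := ∑ i, (leftTranslate (g i)⁻¹ (F i) - F i)
  have hD (t : G) : D t = ((ℓ (L (δ t)) : ℝ) : ℂ) := by
    have hL : L (δ t) = ∑ i, (Pi.single i (δ (g i * t)) - Pi.single i (δ t)) := by
      rw [← Finset.univ_sum_single (L (δ t))]
      refine Finset.sum_congr rfl fun i _ => ?_
      rw [← Pi.single_sub]
      congr 1
      change leftTranslate (g i) (δ t) - δ t = _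
      rw [leftTranslate_single]
    rw [hL, map_sum, lp.coeFn_sum, Finset.sum_apply, Complex.ofReal_sum]
    refine Finset.sum_congr rfl fun i _ => ?_
    rw [map_sub, Complex.ofReal_sub, lp.coeFn_sub, Pi.sub_apply, leftTranslate_apply, inv_inv]
  have hφD : φ D = 0 := by
    simp only [D, map_sum, map_sub, hinv, sub_self, Finset.sum_const_zero]
  have hpos : 0 ≤ φ (D - (u : ℂ) • 1) := by
    refine hφ.nonneg_of_forall_nonneg _ fun t => ?_
    rw [lp.coeFn_sub, Pi.sub_apply, hD, lp.coeFn_smul, Pi.smul_apply, lp.infty_coeFn_one,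
      Pi.one_apply, smul_eq_mul, mul_one, ← Complex.ofReal_sub, Complex.zero_le_real, sub_nonneg]
    exact (hℓ _ (subset_closure ⟨δ t, hδ t, rfl⟩)).le
  rw [map_sub, map_smul, hφ.map_one, hφD, smul_eq_mul, mul_one, zero_sub, ← Complex.ofReal_neg,
    Complex.zero_le_real] at hpos
  linarith

theorem IsAmenableGroup.hasAlmostInvariantVectors {G : Type*} [Group G]
    (h : IsAmenableGroup G) {n : ℕ} (g : Fin n → G) : HasAlmostInvariantVectors g := by
  intro ε hε
  -- The square `ε ^ 2` is needed because `(√a - √b)² ≤ |a - b|` bounds the squared `ℓ²` norm by the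
  -- `ℓ¹` norm.
  obtain ⟨p, hp0, hp1, hp⟩ := h.exists_almost_invariant_prob g (pow_pos hε 2)
  have h2 : 0 < (2 : ℝ≥0∞).toReal := by norm_num
  have hnorm : HasSum (fun t => ‖p t‖) 1 := by
    convert Complex.hasSum_re hp1 using 2 with t
    · rw [Complex.eq_coe_norm_of_nonneg (hp0 t), Complex.ofReal_re, Complex.norm_real, norm_norm]
    · exact Complex.one_re.symm
  have hsq (t : G) : ‖((Real.sqrt ‖p t‖ : ℝ) : ℂ)‖ ^ (2 : ℝ≥0∞).toReal = ‖p t‖ := by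
    rw [Complex.norm_real, Real.norm_eq_abs, abs_of_nonneg (Real.sqrt_nonneg _),
      ENNReal.toReal_ofNat, Real.rpow_two, Real.sq_sqrt (norm_nonneg _)]
  have hmem : Memℓp (fun t => ((Real.sqrt ‖p t‖ : ℝ) : ℂ)) 2 := by
    refine memℓp_gen ?_
    simp_rw [hsq]
    exact hnorm.summable
  let x : lp (fun _ : G => ℂ) 2 := ⟨_, hmem⟩
  refine ⟨x, ?_, fun i => ?_⟩
  · rw [lp.norm_eq_tsum_rpow h2]
    change (∑' t, ‖((Real.sqrt ‖p t‖ : ℝ) : ℂ)‖ ^ (2 : ℝ≥0∞).toReal) ^ _ = (1 : ℝ)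
    simp_rw [hsq, hnorm.tsum_eq, Real.one_rpow]
  · have hs1 : HasSum (fun t => ‖(leftTranslate (g i) p - p) t‖) ‖leftTranslate (g i) p - p‖ := by
      simpa using lp.hasSum_norm (p := 1) (by norm_num) (leftTranslate (g i) p - p)
    refine lp.norm_le_of_forall_sum_le h2 hε.le fun S => ?_
    rw [ENNReal.toReal_ofNat, Real.rpow_two]
    refine le_trans ?_ ((sum_le_hasSum S (fun _ _ => norm_nonneg _) hs1).trans (hp i).le)
    refine Finset.sum_le_sum fun t _ => ?_
    change ‖((Real.sqrt ‖p ((g i)⁻¹ * t)‖ : ℝ) : ℂ) - ((Real.sqrt ‖p t‖ : ℝ) : ℂ)‖ ^ (2 : ℝ) ≤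
      ‖p ((g i)⁻¹ * t) - p t‖
    rw [Real.rpow_two, ← Complex.ofReal_sub, Complex.norm_real, Real.norm_eq_abs, sq_abs]
    refine le_trans ?_ (abs_norm_sub_norm_le _ _)
    have key (a b : ℝ) (ha : 0 ≤ a) (hb : 0 ≤ b) : (√a - √b) ^ 2 ≤ |a - b| := by
      have e : a - b = (√a - √b) * (√a + √b) := by
        nlinarith [Real.sq_sqrt ha, Real.sq_sqrt hb]
      rw [e, abs_mul, ← sq_abs, sq, abs_of_nonneg (a := √a + √b) (by positivity)]
      gcongr
      rw [abs_le]
      constructor <;> linarith [Real.sqrt_nonneg a, Real.sqrt_nonneg b]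
    exact key _ _ (norm_nonneg _) (norm_nonneg _)

/-! ### The pencil of the left regular representation -/

theorem pencil_leftRegularRep_apply {G : Type*} [Group G] {n : ℕ} (g : Fin n → G)
    (z : Fin (n + 1) → ℂ) (x : lp (fun _ : G => ℂ) 2) :
    pencil (repTuple (leftRegularRep G) g) z x =
      z 0 • x + ∑ i : Fin n, z i.succ • leftTranslate (g i) x := by
  rw [pencil, Fin.sum_univ_succ]
  simp only [add_apply, sum_apply]
  rfl

theorem HasAlmostInvariantVectors.not_isUnit_pencil {G : Type*} [Group G] {n : ℕ} {g : Fin n → G}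
    (h : HasAlmostInvariantVectors g) {z : Fin (n + 1) → ℂ} (hz : ∑ i, z i = 0) :
    ¬ IsUnit (pencil (repTuple (leftRegularRep G) g) z) := by
  rintro ⟨u, hu⟩
  set C : ℝ := ‖(↑u⁻¹ : lp (fun _ : G => ℂ) 2 →L[ℂ] lp (fun _ : G => ℂ) 2)‖ *
    ∑ i : Fin n, ‖z i.succ‖ with hC
  have hC0 : 0 ≤ C := by positivity
  -- This tolerance turns the bound by the inverse into `1 ≤ C / (C + 1)`, which is absurd.
  obtain ⟨x, hx1, hx⟩ := h (1 / (C + 1)) (by positivity)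
  have hsum : pencil (repTuple (leftRegularRep G) g) z x =
      ∑ i : Fin n, z i.succ • (leftTranslate (g i) x - x) := by
    rw [Fin.sum_univ_succ] at hz
    rw [pencil_leftRegularRep_apply, eq_neg_of_add_eq_zero_left hz]
    simp only [smul_sub, Finset.sum_sub_distrib, Finset.sum_smul, neg_smul]
    abel
  have hle : ‖pencil (repTuple (leftRegularRep G) g) z x‖ ≤
      (∑ i : Fin n, ‖z i.succ‖) * (1 / (C + 1)) := by
    rw [hsum, Finset.sum_mul]
    refine norm_sum_le_of_le _ fun i _ => ?_
    rw [norm_smul]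
    gcongr
    exact hx i
  have hinv : (↑u⁻¹ : lp (fun _ : G => ℂ) 2 →L[ℂ] lp (fun _ : G => ℂ) 2)
      (pencil (repTuple (leftRegularRep G) g) z x) = x := by
    rw [← hu, ← mul_apply_eq_comp, Units.inv_mul, one_apply_eq_self]
  have : (1 : ℝ) ≤ C * (1 / (C + 1)) := by
    calc (1 : ℝ) = ‖x‖ := hx1.symm
      _ ≤ ‖(↑u⁻¹ : lp (fun _ : G => ℂ) 2 →L[ℂ] lp (fun _ : G => ℂ) 2)‖ *
          ‖pencil (repTuple (leftRegularRep G) g) z x‖ := by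
        conv_lhs => rw [← hinv]
        exact ContinuousLinearMap.le_opNorm _ _
      _ ≤ _ := mul_le_mul_of_nonneg_left hle (norm_nonneg _)
      _ = _ := by rw [hC]; ring
  rw [mul_one_div, le_div_iff₀ (by positivity)] at this
  linarith

theorem hasAlmostInvariantVectors_of_not_isUnit_pencil {G : Type*} [Group G] {n : ℕ}
    {g : Fin n → G}
    (h : ¬ IsUnit (pencil (repTuple (leftRegularRep G) g) (Fin.cons (-(n : ℂ)) fun _ => 1))) :
    HasAlmostInvariantVectors g := by
  intro ε hε
  set S := pencil (repTuple (leftRegularRep G) g) (Fin.cons (-(n : ℂ)) fun _ => 1) with hS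
  have hre (x : lp (fun _ : G => ℂ) 2) :
      ∑ i, ‖leftTranslate (g i) x - x‖ ^ 2 = -2 * (inner ℂ (S x) x : ℂ).re := by
    have hterm (i : Fin n) : ‖leftTranslate (g i) x - x‖ ^ 2 =
        2 * ‖x‖ ^ 2 - 2 * (inner ℂ (leftTranslate (g i) x) x : ℂ).re := by
      rw [@norm_sub_sq ℂ, norm_leftTranslate]
      simp only [RCLike.re_to_complex]
      ring
    rw [hS, pencil_leftRegularRep_apply]
    simp only [Fin.cons_zero, Fin.cons_succ, one_smul, inner_add_left, inner_smul_left, sum_inner,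
      hterm, Finset.sum_sub_distrib, inner_self_eq_norm_sq_to_K, ← Finset.mul_sum,
      Complex.add_re, Complex.re_sum]
    simp [← Complex.ofReal_pow]
    ring
  -- A form bounded below would make `S` invertible. The threshold `ε ^ 2 / 2` absorbs the factor
  -- `-2` in `hre`.
  have hex : ∃ x, ‖(inner ℂ (S x) x : ℂ)‖ < ‖x‖ ^ 2 * (ε ^ 2 / 2) := by
    by_contra! hno
    exact h (ContinuousLinearMap.isUnit_of_forall_le_norm_inner_map S
      (c := (ε ^ 2 / 2).toNNReal) (Real.toNNReal_pos.2 (by positivity))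
      fun x => by rw [Real.coe_toNNReal _ (by positivity)]; exact hno x)
  obtain ⟨x, hx⟩ := hex
  have hx0 : 0 < ‖x‖ := by
    by_contra! h0
    rw [le_antisymm h0 (norm_nonneg x)] at hx
    norm_num at hx
    exact absurd hx (not_lt.2 (norm_nonneg _))
  have hxi (i : Fin n) : ‖leftTranslate (g i) x - x‖ ≤ ε * ‖x‖ := by
    refine abs_le_of_sq_le_sq' ?_ (by positivity) |>.2
    have h1 : ‖leftTranslate (g i) x - x‖ ^ 2 ≤ ∑ i, ‖leftTranslate (g i) x - x‖ ^ 2 :=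
      Finset.single_le_sum (f := fun i => ‖leftTranslate (g i) x - x‖ ^ 2)
        (fun _ _ => sq_nonneg _) (Finset.mem_univ i)
    have h2 := (abs_le.1 (Complex.abs_re_le_norm (inner ℂ (S x) x))).1
    rw [hre] at h1
    nlinarith
  have hn : ‖((‖x‖⁻¹ : ℝ) : ℂ)‖ = ‖x‖⁻¹ := by
    rw [Complex.norm_real, norm_inv, norm_norm]
  refine ⟨((‖x‖⁻¹ : ℝ) : ℂ) • x, ?_, fun i => ?_⟩
  · rw [norm_smul, hn, inv_mul_cancel₀ hx0.ne']
  · change ‖((‖x‖⁻¹ : ℝ) : ℂ) • leftTranslate (g i) x - ((‖x‖⁻¹ : ℝ) : ℂ) • x‖ ≤ ε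
    rw [← smul_sub, norm_smul, hn, inv_mul_le_iff₀ hx0, mul_comm]
    exact hxi i

theorem hasAlmostInvariantVectors_of_isEmpty {G : Type*} [Group G] (g : Fin 0 → G) :
    HasAlmostInvariantVectors g := by
  classical
  intro ε _
  refine ⟨lp.single 2 1 1, ?_, fun i => i.elim0⟩
  rw [lp.norm_single (by simp), norm_one]

end

theorem mainTheorem2 {G : Type*} [Group G] (n : ℕ) (g : Fin n → G)
    (hg : Subgroup.closure (Set.range g) = ⊤) :
    IsAmenableGroup G ↔
      hyperplaneZero n ⊆ projectiveSpectrum (repTuple (leftRegularRep G) g) := by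
  refine ⟨fun h z hz => (h.hasAlmostInvariantVectors g).not_isUnit_pencil hz, fun h => ?_⟩
  refine HasAlmostInvariantVectors.isAmenableGroup ?_ hg
  -- For `n = 0` the test vector `(-n, 1, …, 1)` is zero and gives no projective point.
  rcases n with _ | n
  · exact hasAlmostInvariantVectors_of_isEmpty g
  have hv : (Fin.cons (-((n + 1 : ℕ) : ℂ)) fun _ => 1 : Fin (n + 1 + 1) → ℂ) ≠ 0 := fun h0 => by
    simpa using congrFun h0 (Fin.succ 0)
  refine hasAlmostInvariantVectors_of_not_isUnit_pencil
    ((mk_mem_projectiveSpectrum _ _ hv).1 (h ((mk_mem_hyperplaneZero _ hv).2 ?_)))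
  rw [Fin.sum_univ_succ]
  simp
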